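/- All rings are associative with $1$ and all modules are unital. Let $R$ be a left noetherian ring which is a left CF-ring, that is, every cyclic left $R$-module embeds in a free left $R$-module. Then the following conditions are equivalent: (1) $R$ is left artinian; (2) $R$ is left semiartinian or right semiartinian; ($2_\ell$) $R$ is left semiartinian; ($2_r$) $R$ is right semiartinian; (3) $R$ is semiregular; (4) $R$ is semiperfect; (5) the socle $\operatorname{soc}({}_RR)$ is an essential submodule of the left $R$-module ${}_RR$. Here $\operatorname{soc}(M)$ denotes the sum of all simple submodules of $M$; $R$ is left (right) semiartinian if every non-zero cyclic left (right) $R$-module has a non-zero socle; $R$ is semiregular if $R/\operatorname{rad}R$ is von Neumann regular (i.e. for every $a$ there is $b$ with $aba=a$), where $\operatorname{rad}R$ is the Jacobson radical; and $R$ is semiperfect if $R/\operatorname{rad}R$ is semisimple and every idempotent of $R/\operatorname{rad}R$ lifts to an idempotent of $R$. A submodule $L\subseteq M$ is essential if $L\cap N\neq 0$ for every non-zero submodule $N\subseteq M$. -/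

import Mathlib

universe u v

/-- The socle of a left module: the sum of its simple submodules. -/
def moduleSocle (R : Type u) (M : Type v) [Ring R] [AddCommGroup M] [Module R M] :
    Submodule R M :=
  sSup {N : Submodule R M | IsSimpleModule R N}

/-- A submodule is essential if it meets every nonzero submodule nontrivially. -/
def IsEssentialSubmodule {R : Type u} {M : Type v} [Ring R] [AddCommGroup M] [Module R M]
    (L : Submodule R M) : Prop :=
  ∀ N : Submodule R M, N ≠ ⊥ → L ⊓ N ≠ ⊥

/-- A module is cyclic if it is generated by one element. -/
def IsCyclicModule (R : Type u) (M : Type v) [Ring R] [AddCommGroup M] [Module R M] : Prop :=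
  ∃ x : M, Submodule.span R {x} = ⊤

/-- Left CF-ring: every cyclic left module embeds in a free left module. -/
def IsLeftCFRing (R : Type u) [Ring R] : Prop :=
  ∀ (M : Type u) [AddCommGroup M] [Module R M], IsCyclicModule R M →
    ∃ (F : Type u) (_ : AddCommGroup F) (_ : Module R F) (_ : Module.Free R F)
      (f : M →ₗ[R] F), Function.Injective f

/-- Left semiartinian ring: every nonzero cyclic left module has a nonzero socle. -/
def IsLeftSemiartinianRing (R : Type u) [Ring R] : Prop :=
  ∀ (M : Type u) [AddCommGroup M] [Module R M] [Nontrivial M], IsCyclicModule R M →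
    moduleSocle R M ≠ ⊥

/-- Right semiartinian ring: right `R`-modules are left modules over the opposite ring. -/
def IsRightSemiartinianRing (R : Type u) [Ring R] : Prop :=
  IsLeftSemiartinianRing Rᵐᵒᵖ

/-- Regular ring in the sense of von Neumann. -/
def IsVonNeumannRegularRing (R : Type u) [Ring R] : Prop :=
  ∀ a : R, ∃ b : R, a * b * a = a

/-- Semiregular ring: the quotient by the Jacobson radical is von Neumann regular
(lifting of idempotents is not part of the definition). -/
def IsSemiregularRing (R : Type u) [Ring R] : Prop :=
  IsVonNeumannRegularRing (R ⧸ Ring.jacobson R)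

/-- Semiperfect ring: the quotient by the Jacobson radical is semisimple, and idempotents
lift modulo the radical. -/
def IsSemiperfectRing (R : Type u) [Ring R] : Prop :=
  IsSemisimpleRing (R ⧸ Ring.jacobson R) ∧
    ∀ e : R ⧸ Ring.jacobson R, IsIdempotentElem e →
      ∃ f : R, IsIdempotentElem f ∧ Ideal.Quotient.mk (Ring.jacobson R) f = e

open MulOpposite

/-! For a left noetherian left CF-ring the Jacobson radical `J` is nilpotent: left ideals are left
annihilators, so stabilisation of the right annihilators of the powers of `J` forces `J ^ n = J ^ (n
+ 1)`, and Nakayama applies. By Hopkins–Levitzki, `R` is then artinian as soon as `R ⧸ J` is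
semisimple. Each of von Neumann regularity and right semiartinianness forces this on `R ⧸ J`,
through a maximal choice of idempotent.

On the left side, noetherian plus semiartinian already gives artinian, by stacking simple factors.
An essential left socle gives left semiartinian because cyclic modules embed in free ones, where
elements of minimal support reduce the question to `R`. -/

/-- An element generating a simple submodule, in terms of the action. -/
def IsSimpleElement (R : Type*) {M : Type*} [Ring R] [AddCommGroup M] [Module R M] (x : M) : Prop :=
  x ≠ 0 ∧ ∀ r : R, r • x ≠ 0 → ∃ s : R, s • r • x = x

/-! ### Simple elements and the socle -/

section Socle

variable {R M : Type*} [Ring R] [AddCommGroup M] [Module R M]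

theorem IsSimpleElement.isSimpleModule_span {x : M} (hx : IsSimpleElement R x) :
    IsSimpleModule R (Submodule.span R {x}) := by
  rw [isSimpleModule_iff_isAtom]
  refine ⟨by simpa using hx.1, fun N hN ↦ ?_⟩
  by_contra hbot
  obtain ⟨y, hy, hy0⟩ := N.ne_bot_iff.mp hbot
  obtain ⟨r, rfl⟩ := Submodule.mem_span_singleton.mp (hN.le hy)
  obtain ⟨s, hs⟩ := hx.2 r hy0
  refine hN.not_ge ((Submodule.span_singleton_le_iff_mem ..).mpr ?_)
  rw [← hs]
  exact N.smul_mem s hy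

theorem IsSimpleModule.exists_isSimpleElement [IsSimpleModule R M] :
    ∃ x : M, IsSimpleElement R x := by
  have : Nontrivial M := IsSimpleModule.nontrivial R M
  obtain ⟨x, hx⟩ := exists_ne (0 : M)
  exact ⟨x, hx, fun r hr ↦ IsSimpleModule.toSpanSingleton_surjective R hr x⟩

theorem IsSimpleElement.map {N : Type*} [AddCommGroup N] [Module R N] {f : M →ₗ[R] N}
    (hf : Function.Injective f) {x : M} (hx : IsSimpleElement R x) : IsSimpleElement R (f x) := by
  refine ⟨by simpa using hf.ne hx.1, fun r hr ↦ ?_⟩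
  obtain ⟨s, hs⟩ := hx.2 r fun h ↦ hr (by rw [← map_smul, h, map_zero])
  exact ⟨s, by rw [← map_smul, ← map_smul, hs]⟩

theorem IsSemisimpleModule.exists_isSimpleElement [IsSemisimpleModule R M] [Nontrivial M] :
    ∃ x : M, IsSimpleElement R x := by
  obtain ⟨N, hN⟩ := IsSemisimpleModule.exists_simple_submodule R M
  obtain ⟨x, hx⟩ := IsSimpleModule.exists_isSimpleElement (R := R) (M := N)
  exact ⟨_, hx.map N.injective_subtype⟩

theorem IsSimpleElement.mem_moduleSocle {R : Type u} {M : Type v} [Ring R] [AddCommGroup M]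
    [Module R M] {x : M} (hx : IsSimpleElement R x) : x ∈ moduleSocle R M :=
  le_sSup (a := Submodule.span R {x}) hx.isSimpleModule_span (Submodule.mem_span_singleton_self x)

theorem moduleSocle_ne_bot_iff {R : Type u} {M : Type v} [Ring R] [AddCommGroup M] [Module R M] :
    moduleSocle R M ≠ ⊥ ↔ ∃ x : M, IsSimpleElement R x := by
  refine ⟨fun h ↦ ?_, fun ⟨x, hx⟩ h ↦ hx.1 ?_⟩
  · by_contra! hM
    refine h (le_bot_iff.mp (sSup_le fun N hN ↦ ?_))
    have : IsSimpleModule R N := hN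
    obtain ⟨x, hx⟩ := IsSimpleModule.exists_isSimpleElement (R := R) (M := N)
    exact (hM _ (hx.map N.injective_subtype)).elim
  · simpa [h] using hx.mem_moduleSocle

instance isSemisimpleModule_moduleSocle (R : Type u) (M : Type v) [Ring R] [AddCommGroup M]
    [Module R M] : IsSemisimpleModule R (moduleSocle R M) := by
  rw [moduleSocle, sSup_eq_iSup]
  refine isSemisimpleModule_biSup_of_isSemisimpleModule_submodule fun N hN ↦ ?_
  have : IsSimpleModule R N := hN
  infer_instance

theorem IsEssentialSubmodule.exists_isSimpleElement {R : Type u} {M : Type v} [Ring R]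
    [AddCommGroup M] [Module R M] (h : IsEssentialSubmodule (moduleSocle R M))
    {N : Submodule R M} (hN : N ≠ ⊥) : ∃ x ∈ N, IsSimpleElement R x := by
  have : Nontrivial ↥(moduleSocle R M ⊓ N) := Submodule.nontrivial_iff_ne_bot.mpr (h N hN)
  have : IsSemisimpleModule R ↥(moduleSocle R M ⊓ N) :=
    .of_injective (Submodule.inclusion inf_le_left) (Submodule.inclusion_injective _)
  obtain ⟨x, hx⟩ := IsSemisimpleModule.exists_isSimpleElement (R := R)
    (M := ↥(moduleSocle R M ⊓ N))
  exact ⟨x, x.2.2, hx.map (Submodule.injective_subtype _)⟩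

end Socle

/-! ### Semiartinian, artinian and semiprimary rings -/

section Semiartinian

theorem IsLeftSemiartinianRing.exists_isSimpleElement {R : Type u} [Ring R]
    (h : IsLeftSemiartinianRing R) (M : Type u) [AddCommGroup M] [Module R M] [Nontrivial M] :
    ∃ x : M, IsSimpleElement R x := by
  obtain ⟨m, hm⟩ := exists_ne (0 : M)
  have : Nontrivial (Submodule.span R {m}) :=
    Submodule.nontrivial_iff_ne_bot.mpr (by simpa using hm)
  obtain ⟨x, hx⟩ := moduleSocle_ne_bot_iff.mp (h (Submodule.span R {m})
    ⟨⟨m, Submodule.mem_span_singleton_self m⟩,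
      (Submodule.span_singleton_eq_top_iff ..).mpr fun ⟨y, hy⟩ ↦
        (Submodule.mem_span_singleton.mp hy).imp fun _ h ↦ Subtype.ext h⟩)
  exact ⟨_, hx.map (Submodule.injective_subtype _)⟩

theorem IsLeftSemiartinianRing.of_surjective {R S : Type u} [Ring R] [Ring S]
    (h : IsLeftSemiartinianRing R) (f : R →+* S) (hf : Function.Surjective f) :
    IsLeftSemiartinianRing S := by
  intro M _ _ _ _
  let _ : Module R M := Module.compHom M f
  obtain ⟨x, hx0, hx⟩ := h.exists_isSimpleElement M
  refine moduleSocle_ne_bot_iff.mpr ⟨x, hx0, fun s hs ↦ ?_⟩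
  obtain ⟨r, rfl⟩ := hf s
  obtain ⟨t, ht⟩ := hx r hs
  exact ⟨f t, ht⟩

theorem IsLeftSemiartinianRing.isEssentialSubmodule_moduleSocle {R : Type u} [Ring R]
    (h : IsLeftSemiartinianRing R) (M : Type u) [AddCommGroup M] [Module R M] :
    IsEssentialSubmodule (moduleSocle R M) := by
  intro N hN
  have : Nontrivial N := Submodule.nontrivial_iff_ne_bot.mpr hN
  obtain ⟨x, hx⟩ := h.exists_isSimpleElement N
  exact (Submodule.ne_bot_iff _).mpr
    ⟨x, ⟨(hx.map N.injective_subtype).mem_moduleSocle, x.2⟩, by simpa using hx.1⟩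

/-- A maximal artinian left ideal `I` is everything: otherwise the preimage of a simple submodule of
`R ⧸ I` is an extension of a simple module by `I`, hence artinian and larger. -/
theorem IsLeftSemiartinianRing.isArtinianRing {R : Type u} [Ring R] [IsNoetherianRing R]
    (h : IsLeftSemiartinianRing R) : IsArtinianRing R := by
  obtain ⟨I, hI, hmax⟩ := set_has_maximal_iff_noetherian.mpr (inferInstanceAs (IsNoetherian R R))
    {I : Submodule R R | IsArtinian R I} ⟨⊥, inferInstanceAs (IsArtinian R (⊥ : Submodule R R))⟩
  have : IsArtinian R I := hI
  obtain rfl | hne := eq_or_ne I ⊤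
  · exact Submodule.topEquiv.isArtinian_iff.mp hI
  have : Nontrivial (R ⧸ I) := Submodule.Quotient.nontrivial_iff.mpr hne
  obtain ⟨x, hx⟩ := h.exists_isSimpleElement (R ⧸ I)
  have := hx.isSimpleModule_span
  have hle : I ≤ (Submodule.span R {x}).comap I.mkQ := by
    intro y hy
    simp [(Submodule.Quotient.mk_eq_zero I).mpr hy]
  let g : (Submodule.span R {x}).comap I.mkQ →ₗ[R] Submodule.span R {x} :=
    I.mkQ.restrict fun _ hy ↦ hy
  have hart : IsArtinian R ((Submodule.span R {x}).comap I.mkQ) := by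
    refine isArtinian_of_range_eq_ker (Submodule.inclusion hle) g ?_
    ext y
    simp [g, Submodule.range_inclusion, LinearMap.restrict_apply, Subtype.ext_iff]
  refine (hmax _ hart (lt_of_le_of_ne hle fun heq ↦ hx.1 ?_)).elim
  obtain ⟨r, rfl⟩ := I.mkQ_surjective x
  have : r ∈ I := heq ▸ Submodule.mem_span_singleton_self (I.mkQ r)
  simpa using this

theorem IsArtinianRing.isLeftSemiartinianRing (R : Type u) [Ring R] [IsArtinianRing R] :
    IsLeftSemiartinianRing R := by
  intro M _ _ _ ⟨m, hm⟩
  have : Module.Finite R M := ⟨⟨{m}, by simpa using hm⟩⟩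
  obtain ⟨N, hN, -⟩ := (IsAtomic.eq_bot_or_exists_atom_le (⊤ : Submodule R M)).resolve_left
    top_ne_bot
  have : IsSimpleModule R N := isSimpleModule_iff_isAtom.mpr hN
  obtain ⟨x, hx⟩ := IsSimpleModule.exists_isSimpleElement (R := R) (M := N)
  exact moduleSocle_ne_bot_iff.mpr ⟨_, hx.map N.injective_subtype⟩

/-- A nonzero right module over a ring with a nilpotent ideal `J` has a nonzero element
annihilated by `J`. -/
theorem exists_ne_zero_forall_op_smul_eq_zero {R M : Type*} [Ring R] [AddCommGroup M]
    [Module Rᵐᵒᵖ M] [Nontrivial M] {J : Ideal R} [J.IsTwoSided] (hJ : IsNilpotent J) :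
    ∃ m : M, m ≠ 0 ∧ ∀ j ∈ J, op j • m = 0 := by
  suffices ∀ n (m : M), m ≠ 0 → (∀ j ∈ J ^ n, op j • m = 0) →
      ∃ m : M, m ≠ 0 ∧ ∀ j ∈ J, op j • m = 0 by
    obtain ⟨n, hn⟩ := hJ
    obtain ⟨m, hm⟩ := exists_ne (0 : M)
    refine this n m hm fun j hj ↦ ?_
    rw [hn] at hj
    simp [show j = 0 from hj]
  intro n
  induction n with
  | zero => exact fun m hm h ↦ (hm (by simpa using h 1 (by simp [Submodule.pow_zero, Ideal.one_eq_top]))).elim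
  | succ n ih =>
    intro m hm hmn
    by_cases! h : ∀ j ∈ J, op j • m = 0
    · exact ⟨m, hm, h⟩
    obtain ⟨j, hj, hjm⟩ := h
    -- If `mj ≠ 0`, then `mj` is killed by `J ^ n`, since `j * J ^ n` lies in `J ^ (n + 1)`.
    refine ih _ hjm fun i hi ↦ ?_
    rw [← mul_smul, ← op_mul]
    exact hmn _ (Ideal.IsTwoSided.pow_succ (I := J) n ▸ Ideal.mul_mem_mul hj hi)

/-- Semiprimary rings are right semiartinian. -/
theorem IsSemiprimaryRing.isRightSemiartinianRing (R : Type u) [Ring R] [IsSemiprimaryRing R] :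
    IsRightSemiartinianRing R := by
  intro M _ _ _ _
  obtain ⟨m, hm0, hm⟩ := exists_ne_zero_forall_op_smul_eq_zero (M := M)
    (IsSemiprimaryRing.isNilpotent (R := R))
  let π := Ideal.Quotient.mk (Ring.jacobson R)
  have hπ (r r' : R) (h : π r = π r') : op r • m = op r' • m := by
    rw [← sub_eq_zero, ← sub_smul, ← op_sub]
    exact hm _ (Ideal.Quotient.eq.mp h)
  -- `A` is the annihilator of `m` over `R ⧸ J`, so its quotient models `mR` and is semisimple.
  let A : Ideal (R ⧸ Ring.jacobson R)ᵐᵒᵖ :=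
    { carrier := {t | ∀ r, π r = unop t → op r • m = 0}
      zero_mem' := fun r hr ↦ hm r (Ideal.Quotient.eq_zero_iff_mem.mp hr)
      add_mem' := by
        intro a b ha hb r hr
        obtain ⟨x, hx⟩ := Ideal.Quotient.mk_surjective (unop a)
        obtain ⟨y, hy⟩ := Ideal.Quotient.mk_surjective (unop b)
        rw [hπ r (x + y) (by rw [hr, map_add, unop_add]; exact (congrArg₂ _ hx hy).symm),
          op_add, add_smul, ha x hx, hb y hy, add_zero]
      smul_mem' := by
        intro c a ha r hr
        obtain ⟨x, hx⟩ := Ideal.Quotient.mk_surjective (unop a)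
        obtain ⟨y, hy⟩ := Ideal.Quotient.mk_surjective (unop c)
        rw [hπ r (x * y) (by
          rw [hr, map_mul, smul_eq_mul, unop_mul]; exact (congrArg₂ _ hx hy).symm),
          op_mul, mul_smul, ha x hx, smul_zero] }
  have hA (r : R) : op (π r) ∈ A ↔ op r • m = 0 :=
    ⟨fun h ↦ h r rfl, fun h r' hr' ↦ (hπ r' r hr').trans h⟩
  have : Nontrivial ((R ⧸ Ring.jacobson R)ᵐᵒᵖ ⧸ A) := by
    refine Submodule.Quotient.nontrivial_iff.mpr fun h ↦ hm0 ?_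
    simpa using (hA 1).mp (h ▸ Submodule.mem_top)
  obtain ⟨x, hx0, hx⟩ := IsSemisimpleModule.exists_isSimpleElement
    (R := (R ⧸ Ring.jacobson R)ᵐᵒᵖ) (M := (R ⧸ Ring.jacobson R)ᵐᵒᵖ ⧸ A)
  obtain ⟨t, rfl⟩ := A.mkQ_surjective x
  obtain ⟨r, hr⟩ := Ideal.Quotient.mk_surjective (unop t)
  obtain rfl : t = op (π r) := unop_injective hr.symm
  refine moduleSocle_ne_bot_iff.mpr ⟨op r • m, fun h ↦ hx0 ?_, fun q hq ↦ ?_⟩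
  · simpa using (hA r).mpr h
  obtain ⟨q, rfl⟩ := op_surjective q
  obtain ⟨s, hs⟩ := hx (op (π q)) fun h ↦ hq <| by
    rw [← mul_smul, ← op_mul, ← hA]
    rwa [← map_smul, Submodule.mkQ_apply, Submodule.Quotient.mk_eq_zero] at h
  obtain ⟨p, hp⟩ := Ideal.Quotient.mk_surjective (unop s)
  obtain rfl : s = op (π p) := unop_injective hp.symm
  refine ⟨op p, ?_⟩
  rw [← map_smul, ← map_smul, ← sub_eq_zero, ← map_sub, Submodule.mkQ_apply,
    Submodule.Quotient.mk_eq_zero] at hs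
  have := (hA (r * q * p - r)).mp (by simpa [mul_assoc] using hs)
  rw [op_sub, sub_smul, sub_eq_zero] at this
  simpa [mul_smul] using this

end Semiartinian

/-! ### Semisimplicity of regular and semiprime rings -/

section Semisimple

variable {R : Type*} [Ring R]

theorem isCompl_span_of_isIdempotentElem {e : R} (he : IsIdempotentElem e) :
    IsCompl (Ideal.span {e}) (Ideal.span {1 - e}) := by
  constructor
  · rw [Submodule.disjoint_def]
    intro x hx hx'
    obtain ⟨a, rfl⟩ := Ideal.mem_span_singleton'.mp hx
    obtain ⟨b, hb⟩ := Ideal.mem_span_singleton'.mp hx'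
    calc a * e = a * e * e := by rw [mul_assoc, he.eq]
      _ = 0 := by rw [← hb, mul_assoc, he.one_sub_mul_self, mul_zero]
  · rw [codisjoint_iff, Ideal.eq_top_iff_one]
    exact Submodule.mem_sup.mpr ⟨e, Ideal.mem_span_singleton_self e, 1 - e,
      Ideal.mem_span_singleton_self _, by simp⟩

/-- Every left ideal `I` is generated by an idempotent: take `Re ⊆ I` maximal with `e` idempotent.
An element of `I` outside `Re` would yield an idempotent orthogonal to `e`, enlarging `Re`. -/
theorem IsVonNeumannRegularRing.isSemisimpleRing {R : Type u} [Ring R] [IsNoetherianRing R]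
    (h : IsVonNeumannRegularRing R) : IsSemisimpleRing R := by
  refine { exists_isCompl := fun (I : Ideal R) ↦ ?_ }
  obtain ⟨_, ⟨e, he, heI, rfl⟩, hmax⟩ := set_has_maximal_iff_noetherian.mpr
    (inferInstanceAs (IsNoetherian R R))
    {K : Submodule R R | ∃ e ∈ I, IsIdempotentElem e ∧ K = Ideal.span {e}}
    ⟨_, 0, I.zero_mem, .zero, rfl⟩
  suffices I = Ideal.span {e} from ⟨_, this ▸ isCompl_span_of_isIdempotentElem heI⟩
  refine le_antisymm (fun a ha ↦ ?_) ((Ideal.span_singleton_le_iff_mem _).mpr he)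
  obtain ⟨c, hc⟩ := h (a * (1 - e))
  set b := a * (1 - e) with hb
  have hbI : b ∈ I := by
    rw [hb, mul_sub, mul_one]
    exact I.sub_mem ha (I.mul_mem_left _ he)
  have hbe : b * e = 0 := by rw [hb, mul_assoc, heI.one_sub_mul_self, mul_zero]
  have hbe' : b * (1 - e) = b := by rw [mul_sub, hbe, mul_one, sub_zero]
  -- Regularity makes `cb` an idempotent generating `Rb`; the factor `1 - e` also gives `eg = 0`.
  set g := (1 - e) * c * b with hg
  have hge : g * e = 0 := by rw [hg, mul_assoc, hbe, mul_zero]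
  have heg : e * g = 0 := by
    rw [hg, mul_assoc, ← mul_assoc, heI.mul_one_sub_self, zero_mul]
  have hgg : g * g = g := by
    calc g * g = (1 - e) * c * (b * (1 - e)) * c * b := by rw [hg]; noncomm_ring
      _ = (1 - e) * c * (b * c * b) := by rw [hbe']; noncomm_ring
      _ = g := by rw [hc]
  have hbg : b * g = b := by
    calc b * g = (b * (1 - e)) * c * b := by rw [hg]; noncomm_ring
      _ = b := by rw [hbe', hc]
  have hidem : IsIdempotentElem (e + g) := by
    rw [IsIdempotentElem, add_mul, mul_add, mul_add, heI.eq, heg, hge, hgg]; simp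
  have hle : Ideal.span {e} ≤ Ideal.span {e + g} :=
    (Ideal.span_singleton_le_iff_mem _).mpr <|
      Ideal.mem_span_singleton'.mpr ⟨e, by rw [mul_add, heI.eq, heg, add_zero]⟩
  have heq : Ideal.span {e} = Ideal.span {e + g} :=
    (hle.lt_or_eq).resolve_left <|
      hmax _ ⟨e + g, I.add_mem he (I.mul_mem_left _ hbI), hidem, rfl⟩
  obtain ⟨d, hd⟩ := Ideal.mem_span_singleton'.mp (heq ▸ Ideal.mem_span_singleton_self (e + g))
  have hg0 : g = 0 := by
    calc g = (e + g) * g := by rw [add_mul, heg, hgg, zero_add]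
      _ = 0 := by rw [← hd, mul_assoc, heg, mul_zero]
  rw [hg0, mul_zero] at hbg
  exact Ideal.mem_span_singleton'.mpr ⟨a, by
    rw [← sub_eq_zero, ← neg_eq_zero, neg_sub]; simpa [mul_sub, ← hbg] using hb.symm⟩

theorem IsSemisimpleRing.isVonNeumannRegularRing (R : Type u) [Ring R] [IsSemisimpleRing R] :
    IsVonNeumannRegularRing R := by
  intro a
  obtain ⟨e, he, hspan⟩ := IsSemisimpleRing.ideal_eq_span_idempotent (Ideal.span {a})
  obtain ⟨b, hb⟩ := Ideal.mem_span_singleton'.mp (hspan ▸ Ideal.mem_span_singleton_self e)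
  obtain ⟨c, hc⟩ := Ideal.mem_span_singleton'.mp (hspan ▸ Ideal.mem_span_singleton_self a)
  exact ⟨b, by rw [mul_assoc, hb, ← hc, mul_assoc, he.eq]⟩

/-- In a semiprime ring, a minimal left ideal is generated by an idempotent. -/
theorem IsSimpleElement.exists_isIdempotentElem {x : R} (hx : IsSimpleElement R x)
    (hR : ∀ x : R, (∀ a, x * a * x = 0) → x = 0) :
    ∃ g ∈ Ideal.span {x}, IsIdempotentElem g ∧ g ≠ 0 := by
  obtain ⟨a, ha⟩ : ∃ a, x * a * x ≠ 0 := by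
    by_contra! h
    exact hx.1 (hR x h)
  obtain ⟨s, hs⟩ := hx.2 (x * a) ha
  simp only [smul_eq_mul] at hs
  have hgax : a * s * x * (a * x) = a * x := by
    calc a * s * x * (a * x) = a * (s * (x * a * x)) := by noncomm_ring
      _ = a * x := by rw [hs]
  -- Write `g = asx`. Then `g² - g` kills `ax`; if it were nonzero, it would generate `Rx` by
  -- simplicity, giving `xax = 0`.
  refine ⟨a * s * x, Ideal.mem_span_singleton'.mpr ⟨_, rfl⟩, ?_, fun h0 ↦ ?_⟩
  · rw [IsIdempotentElem, ← sub_eq_zero]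
    by_contra hne
    have hfac : (a * s * x * (a * s) - a * s) * x = a * s * x * (a * s * x) - a * s * x := by
      noncomm_ring
    obtain ⟨t, ht⟩ := hx.2 (a * s * x * (a * s) - a * s) (by rwa [smul_eq_mul, hfac])
    simp only [smul_eq_mul] at ht
    apply ha
    calc x * a * x = t * ((a * s * x * (a * s) - a * s) * x) * (a * x) := by rw [ht, mul_assoc]
      _ = t * (a * s * x * (a * s * x * (a * x)) - a * s * x * (a * x)) := by
        rw [hfac]; noncomm_ring
      _ = 0 := by rw [hgax, hgax, sub_self, mul_zero]
  · rw [h0, zero_mul] at hgax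
    exact ha (by rw [mul_assoc, ← hgax, mul_zero])

/-- A left semiartinian semiprime right noetherian ring is semisimple. -/
theorem IsLeftSemiartinianRing.isSemisimpleRing {R : Type u} [Ring R] [IsNoetherianRing Rᵐᵒᵖ]
    (h : IsLeftSemiartinianRing R) (hR : ∀ x : R, (∀ a, x * a * x = 0) → x = 0) :
    IsSemisimpleRing R := by
  -- The right ideal `eR` is maximised, because the chain condition is on the right; semisimplicity
  -- is asked of the left ideal `Re`.
  obtain ⟨_, ⟨e, he, hess, rfl⟩, hmax⟩ := set_has_maximal_iff_noetherian.mpr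
    (inferInstanceAs (IsNoetherian Rᵐᵒᵖ Rᵐᵒᵖ))
    {K : Submodule Rᵐᵒᵖ Rᵐᵒᵖ | ∃ e : R, IsIdempotentElem e ∧
      IsSemisimpleModule R (Ideal.span {e}) ∧ K = Ideal.span {op e}}
    ⟨_, 0, .zero, by
      rw [Ideal.span_singleton_eq_bot.mpr rfl]
      exact sSup_simples_eq_top_iff_isSemisimpleModule.mp (Subsingleton.elim _ _), rfl⟩
  obtain rfl | he1 := eq_or_ne e 1
  · rw [Ideal.span_singleton_one] at hess
    exact Submodule.topEquiv.isSemisimpleModule_iff.mp hess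
  have : Nontrivial (Ideal.span {1 - e}) := by
    rw [Submodule.nontrivial_iff_ne_bot, Ne, Ideal.span_singleton_eq_bot, sub_eq_zero]
    exact he1.symm
  obtain ⟨⟨x, hxe⟩, hx⟩ := h.exists_isSimpleElement (Ideal.span {1 - e})
  replace hx : IsSimpleElement R x := hx.map (Submodule.injective_subtype _)
  obtain ⟨g, hgx, hg, hg0⟩ := hx.exists_isIdempotentElem hR
  have hge : g * e = 0 := by
    obtain ⟨c, rfl⟩ := Ideal.mem_span_singleton'.mp hgx
    obtain ⟨d, rfl⟩ := Ideal.mem_span_singleton'.mp hxe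
    rw [mul_assoc, mul_assoc, he.one_sub_mul_self, mul_zero, mul_zero]
  -- Already `ge = 0`; multiplying by `1 - e` gives orthogonality to `e` on the other side too.
  set k := (1 - e) * g with hk
  have hek : e * k = 0 := by rw [hk, ← mul_assoc, he.mul_one_sub_self, zero_mul]
  have hke : k * e = 0 := by rw [hk, mul_assoc, hge, mul_zero]
  have hgk : g * k = g := by rw [hk, ← mul_assoc, mul_sub, hge, mul_one, sub_zero, hg.eq]
  have hkk : k * k = k := by
    conv_lhs => rw [hk, mul_assoc, hgk]
  have hidem : IsIdempotentElem (e + k) := by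
    rw [IsIdempotentElem, add_mul, mul_add, mul_add, he.eq, hek, hke, hkk]; simp
  have hk0 : k ≠ 0 := fun h0 ↦ hg0 (by rw [← hgk, h0, mul_zero])
  have := hx.isSimpleModule_span
  have hle : Ideal.span {e + k} ≤ Ideal.span {e} ⊔ Submodule.span R {x} :=
    (Ideal.span_singleton_le_iff_mem _).mpr <|
      add_mem (Submodule.mem_sup_left (Ideal.mem_span_singleton_self e))
        (Submodule.mem_sup_right (Ideal.mul_mem_left _ _ hgx))
  have hsup : IsSemisimpleModule R ↥(Ideal.span {e} ⊔ Submodule.span R {x}) :=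
    .sup hess inferInstance
  have hss : IsSemisimpleModule R (Ideal.span {e + k}) :=
    .of_injective (Submodule.inclusion hle) (Submodule.inclusion_injective _)
  have hle' : Ideal.span {op e} ≤ Ideal.span {op (e + k)} :=
    (Ideal.span_singleton_le_iff_mem _).mpr <| Ideal.mem_span_singleton'.mpr
      ⟨op e, by rw [← op_mul, add_mul, he.eq, hke, add_zero]⟩
  have heq : Ideal.span {op e} = Ideal.span {op (e + k)} :=
    hle'.lt_or_eq.resolve_left <| hmax _ ⟨e + k, hidem, hss, rfl⟩
  obtain ⟨d, hd⟩ := Ideal.mem_span_singleton'.mp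
    (heq ▸ Ideal.mem_span_singleton_self (op (e + k)))
  have hd' : e * unop d = e + k := congrArg unop hd
  refine (hk0 ?_).elim
  calc k = k * (e + k) := by rw [mul_add, hke, hkk, zero_add]
    _ = 0 := by rw [← hd', ← mul_assoc, hke, zero_mul]

/-- If `x` is outside a maximal left ideal `m`, write `1 = y + ax` with `y ∈ m`; then `x = xy + xax
= xy ∈ m`. -/
theorem eq_zero_of_forall_mul_mul_eq_zero_of_jacobson_eq_bot (hJ : Ring.jacobson R = ⊥) {x : R}
    (hx : ∀ a, x * a * x = 0) : x = 0 := by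
  rw [← Submodule.mem_bot R, ← hJ, Ring.jacobson_eq_sInf_isMaximal, Ideal.mem_sInf]
  intro m hm
  by_contra hxm
  obtain ⟨y, hy, z, hz, hyz⟩ := Submodule.mem_sup.mp
    ((Ideal.eq_top_iff_one _).mp (Ideal.isMaximal_def.mp hm |>.2 (m ⊔ Ideal.span {x})
      (left_lt_sup.mpr (by rwa [Ideal.span_singleton_le_iff_mem]))))
  obtain ⟨a, rfl⟩ := Ideal.mem_span_singleton'.mp hz
  apply hxm
  rw [← mul_one x, ← hyz, mul_add, ← mul_assoc, hx, add_zero]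
  exact m.mul_mem_left x hy

/-- The semiprime criterion is applied to the opposite of `R ⧸ J`: semiprimeness and semisimplicity
are left-right symmetric. -/
theorem IsRightSemiartinianRing.isSemisimpleRing_quotient_jacobson {R : Type u} [Ring R]
    [IsNoetherianRing R] (h : IsRightSemiartinianRing R) :
    IsSemisimpleRing (R ⧸ Ring.jacobson R) := by
  rw [← isSemisimpleRing_mulOpposite_iff]
  have : IsNoetherianRing (R ⧸ Ring.jacobson R)ᵐᵒᵖᵐᵒᵖ :=
    isNoetherianRing_of_surjective R _
      ((RingEquiv.opOp (R ⧸ Ring.jacobson R)).toRingHom.comp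
        (Ideal.Quotient.mk (Ring.jacobson R)))
      ((RingEquiv.opOp (R ⧸ Ring.jacobson R)).surjective.comp Ideal.Quotient.mk_surjective)
  have h' : IsLeftSemiartinianRing (R ⧸ Ring.jacobson R)ᵐᵒᵖ :=
    IsLeftSemiartinianRing.of_surjective h (Ideal.Quotient.mk (Ring.jacobson R)).op
      fun x ↦ by
        obtain ⟨r, hr⟩ := Ideal.Quotient.mk_surjective (unop x)
        exact ⟨op r, unop_injective hr⟩
  refine h'.isSemisimpleRing fun x hx ↦ unop_injective ?_
  refine eq_zero_of_forall_mul_mul_eq_zero_of_jacobson_eq_bot (Ring.jacobson_quotient_jacobson R)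
    fun a ↦ ?_
  simpa [mul_assoc] using congrArg unop (hx (op a))

end Semisimple

/-! ### Consequences of the CF condition -/

section CF

/-- In a left CF-ring every left ideal is a left annihilator. -/
theorem IsLeftCFRing.exists_forall_mul_eq_zero {R : Type u} [Ring R] (h : IsLeftCFRing R)
    {I : Ideal R} {a : R} (ha : a ∉ I) : ∃ x, (∀ y ∈ I, y * x = 0) ∧ a * x ≠ 0 := by
  obtain ⟨F, _, _, _, f, hf⟩ := h (R ⧸ I) ⟨I.mkQ 1, by
    rw [← Set.image_singleton, Submodule.span_image, ← Ideal.span, Ideal.span_singleton_one,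
      Submodule.map_top, Submodule.range_mkQ]⟩
  -- The witness is a coordinate of the image of `1 + I`.
  let b := Module.Free.chooseBasis R F
  have key (r : R) (i) : b.repr (f (I.mkQ r)) i = r * b.repr (f (I.mkQ 1)) i := by
    conv_lhs => rw [← mul_one r, ← smul_eq_mul, map_smul, map_smul, map_smul]
    simp
  have hne : b.repr (f (I.mkQ a)) ≠ 0 := by
    rw [Ne, map_eq_zero_iff _ b.repr.injective, map_eq_zero_iff f hf]
    simpa using ha
  obtain ⟨i, hi⟩ := Finsupp.ne_iff.mp hne
  refine ⟨b.repr (f (I.mkQ 1)) i, fun y hy ↦ ?_, by rwa [← key]⟩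
  rw [← key, Submodule.mkQ_apply, (Submodule.Quotient.mk_eq_zero I).mpr hy]
  simp

/-- If `J ^ n` and `J ^ (n + 1)` have the same right annihilator, they are equal, both being left
annihilators. -/
theorem IsLeftCFRing.isNilpotent_jacobson {R : Type u} [Ring R] [IsNoetherianRing R]
    (h : IsLeftCFRing R) : IsNilpotent (Ring.jacobson R) := by
  let ann (n : ℕ) : Ideal R :=
    { carrier := {x | ∀ y ∈ Ring.jacobson R ^ n, y * x = 0}
      zero_mem' := fun y _ ↦ mul_zero y
      add_mem' := fun ha hb y hy ↦ by rw [mul_add, ha y hy, hb y hy, add_zero]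
      smul_mem' := fun c x hx y hy ↦ by
        rw [smul_eq_mul, ← mul_assoc]
        exact hx _ (Ideal.mul_mem_right c _ hy) }
  have hmono : Monotone ann := fun m n hmn x hx y hy ↦ hx y (Ideal.pow_le_pow_right hmn hy)
  obtain ⟨n, hn⟩ := monotone_stabilizes_iff_noetherian.mpr
    (inferInstanceAs (IsNoetherian R R)) ⟨ann, hmono⟩
  refine ⟨n, (IsNoetherian.noetherian (Ring.jacobson R ^ n)).eq_bot_of_le_jacobson_smul ?_⟩
  rw [Ideal.smul_eq_mul, ← Ideal.IsTwoSided.pow_succ]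
  intro a ha
  by_contra ha'
  obtain ⟨x, hx, hax⟩ := h.exists_forall_mul_eq_zero ha'
  have hx' : x ∈ ann n := (show ann n = ann (n + 1) from hn _ n.le_succ) ▸ hx
  exact hax (hx' a ha)

theorem IsLeftCFRing.isArtinianRing {R : Type u} [Ring R] [IsNoetherianRing R]
    (h : IsLeftCFRing R) (hss : IsSemisimpleRing (R ⧸ Ring.jacobson R)) : IsArtinianRing R :=
  have : IsSemiprimaryRing R := ⟨hss, h.isNilpotent_jacobson⟩
  IsSemiprimaryRing.isNoetherian_iff_isArtinian.mp ‹IsNoetherianRing R›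

/-- If the left socle of `R` is essential, a nonzero submodule of a free module has a simple
submodule: a nonzero element of minimal support can be scaled to generate one. -/
theorem IsEssentialSubmodule.exists_isSimpleElement_of_injective {R : Type u} [Ring R]
    (h : IsEssentialSubmodule (moduleSocle R R)) {M ι : Type*} [AddCommGroup M] [Module R M]
    [Nontrivial M] (f : M →ₗ[R] ι →₀ R) (hf : Function.Injective f) :
    ∃ x : M, IsSimpleElement R x := by
  obtain ⟨w, hw0, hw⟩ := exists_minimalFor_of_wellFoundedLT (fun x : M ↦ x ≠ 0)
    (fun x ↦ (f x).support) (exists_ne 0)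
  have hf0 : f w ≠ 0 := by rwa [Ne, map_eq_zero_iff f hf]
  obtain ⟨i, hi⟩ := Finsupp.ne_iff.mp hf0
  -- By minimality, the `i`-th coordinate is injective on `Rw`, so simplicity of `r • f w i` in `R`
  -- transfers to `r • w`.
  have hmin (y : M) (hy : (f y).support ⊆ (f w).support) (hyi : f y i = 0) : y = 0 := by
    by_contra hy0
    exact (Finsupp.mem_support_iff.mp (hw hy0 hy (Finsupp.mem_support_iff.mpr hi))) hyi
  obtain ⟨c, hc, hc0, hcs⟩ := h.exists_isSimpleElement (N := Submodule.span R {f w i})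
    (by simpa using hi)
  obtain ⟨r, rfl⟩ := Submodule.mem_span_singleton.mp hc
  have hsupp (t : R) : (f (t • w)).support ⊆ (f w).support := by
    rw [map_smul]; exact Finsupp.support_smul
  refine ⟨r • w, fun h0 ↦ hc0 ?_, fun t ht ↦ ?_⟩
  · rw [← Finsupp.smul_apply, ← map_smul, h0, map_zero, Finsupp.zero_apply]
  obtain ⟨s, hs⟩ := hcs t fun h0 ↦ ht <| by
    rw [← mul_smul]
    exact hmin _ (hsupp _) (by rw [map_smul, Finsupp.smul_apply, mul_smul, h0])
  refine ⟨s, ?_⟩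
  rw [← sub_eq_zero, ← mul_smul, ← mul_smul, ← sub_smul]
  refine hmin _ (hsupp _) ?_
  rw [map_smul, Finsupp.smul_apply, sub_smul, mul_smul, mul_smul, hs, sub_self]

theorem IsLeftCFRing.isLeftSemiartinianRing {R : Type u} [Ring R] (hCF : IsLeftCFRing R)
    (h : IsEssentialSubmodule (moduleSocle R R)) : IsLeftSemiartinianRing R := by
  intro M _ _ _ hM
  obtain ⟨F, _, _, _, f, hf⟩ := hCF M hM
  let b := Module.Free.chooseBasis R F
  exact moduleSocle_ne_bot_iff.mpr <| h.exists_isSimpleElement_of_injective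
    (b.repr.toLinearMap ∘ₗ f) (b.repr.injective.comp hf)

end CF

/-! ### Lifting idempotents and the equivalences -/

theorem IsArtinianRing.isSemiperfectRing (R : Type u) [Ring R] [IsArtinianRing R] :
    IsSemiperfectRing R := by
  refine ⟨inferInstance, fun e he ↦ ?_⟩
  refine exists_isIdempotentElem_eq_of_ker_isNilpotent
    (Ideal.Quotient.mk (Ring.jacobson R)) (fun x hx ↦ ?_) e
    (Ideal.Quotient.mk_surjective e) he
  obtain ⟨n, hn⟩ := IsSemiprimaryRing.isNilpotent (R := R)
  rw [Ideal.mk_ker] at hx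
  exact ⟨n, by simpa [hn] using Ideal.pow_mem_pow hx n⟩

theorem mainTheorem9 (R : Type u) [Ring R] [IsNoetherianRing R] (hCF : IsLeftCFRing R) :
    List.TFAE [
      IsArtinianRing R,
      IsLeftSemiartinianRing R ∨ IsRightSemiartinianRing R,
      IsLeftSemiartinianRing R,
      IsRightSemiartinianRing R,
      IsSemiregularRing R,
      IsSemiperfectRing R,
      IsEssentialSubmodule (moduleSocle R R)] := by
  tfae_have 1 → 3 := fun _ ↦ IsArtinianRing.isLeftSemiartinianRing R
  tfae_have 1 → 4 := fun _ ↦ IsSemiprimaryRing.isRightSemiartinianRing R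
  tfae_have 1 → 6 := fun _ ↦ IsArtinianRing.isSemiperfectRing R
  tfae_have 3 → 2 := Or.inl
  tfae_have 4 → 2 := Or.inr
  tfae_have 2 → 1 := fun h ↦ h.elim (·.isArtinianRing)
    fun h ↦ hCF.isArtinianRing h.isSemisimpleRing_quotient_jacobson
  tfae_have 6 → 5 := fun ⟨_, _⟩ ↦ IsSemisimpleRing.isVonNeumannRegularRing _
  tfae_have 5 → 1 := fun h ↦ hCF.isArtinianRing <|
    have := isNoetherianRing_of_surjective R _ (Ideal.Quotient.mk (Ring.jacobson R))
      Ideal.Quotient.mk_surjective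
    IsVonNeumannRegularRing.isSemisimpleRing h
  tfae_have 3 → 7 := fun h ↦ h.isEssentialSubmodule_moduleSocle R
  tfae_have 7 → 3 := hCF.isLeftSemiartinianRing
  tfae_finish
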